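/- Let $F$ be a non-archimedean local field with ring of integers $\mathfrak o_F$ and maximal ideal $\mathfrak p_F$, let $D$ be a finite-dimensional division algebra with centre $F$, and let $m\ge 1$. Let $G=\mathrm{GL}_m(D)$, let $\mathrm{Nrd}\colon G\to F^\times$ be the reduced norm and $G_{\mathrm{der}}=\mathrm{GL}_m(D)_{\mathrm{der}}=\ker(\mathrm{Nrd})$. For a hereditary $\mathfrak o_F$-order $\mathfrak A$ in $M_m(D)$ with Jacobson radical $\mathfrak P$, let $e_F(\mathfrak A)\ge 1$ be the integer with $\mathfrak p_F\mathfrak A=\mathfrak P^{e_F(\mathfrak A)}$, and put $U^{j}(\mathfrak A)=1+\mathfrak P^{j}$ for $j\ge 1$. For an irreducible smooth complex representation $\rho$ of $H\in\{G,G_{\mathrm{der}}\}$, the depth (normalized level) of $\rho$ is $$d(\rho)=\min\{\, j/e_F(\mathfrak A)\,\},$$ where $(j,\mathfrak A)$ ranges over all pairs of an integer $j\ge 0$ and a hereditary $\mathfrak o_F$-order $\mathfrak A$ in $M_m(D)$ such that $\rho$ has a nonzero vector fixed by $U^{j+1}(\mathfrak A)\cap H$. Let $\pi$ be an irreducible smooth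 complex representation of $G_{\mathrm{der}}$ and $\overline\pi$ an irreducible smooth complex representation of $G$ such that * $\pi$ is (isomorphic to) a direct summand of the restriction of $\overline\pi$ to $G_{\mathrm{der}}$; * $d(\overline\pi)\le d(\overline\pi\otimes\chi\circ\mathrm{Nrd})$ for every continuous character $\chi\colon F^\times\to\mathbb C^\times$. Then $d(\pi)=d(\overline\pi)$. -/

import Mathlib

open scoped TensorProduct ENNReal

/-! ### The reduced norm of a central simple algebra

The next lemmas show that a central simple algebra over a field `F` splits over the separable
closure of `F`, and that determinants computed through a splitting lie in `F`. They are only used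
to define the reduced norm. -/

namespace CSA

section
variable (F L A : Type*) [Field F] [Field L] [Algebra F L] [Ring A] [Algebra F A]

open Classical in
theorem exists_mulLeftRight_eq [FiniteDimensional F A] [Algebra.IsCentral F A] [IsSimpleRing A]
    (f : Module.End F A) : ∃ t : A ⊗[F] Aᵐᵒᵖ, AlgHom.mulLeftRight F A t = f := by
  let T : Subalgebra F (Module.End F A) := (AlgHom.mulLeftRight F A).range
  have hT (a b : A) : ∃ t : T, ∀ x : A, t • x = a * x * b :=
    ⟨⟨AlgHom.mulLeftRight F A (a ⊗ₜ MulOpposite.op b), ⟨_, rfl⟩⟩, fun x ↦ by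
      change AlgHom.mulLeftRight F A (a ⊗ₜ MulOpposite.op b) x = _
      simp⟩
  have hsimple : IsSimpleModule T A := by
    rw [isSimpleModule_iff]
    refine { exists_pair_ne := ⟨⊥, ⊤, bot_ne_top⟩, eq_bot_or_eq_top := fun N ↦ ?_ }
    let I : TwoSidedIdeal A := TwoSidedIdeal.mk' N N.zero_mem N.add_mem (fun {y} hy ↦ by
        obtain ⟨t, ht⟩ := hT (-1) 1
        simpa [ht] using N.smul_mem t hy)
      (fun {x y} hy ↦ by
        obtain ⟨t, ht⟩ := hT x 1
        simpa [ht] using N.smul_mem t hy)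
      (fun {x y} hx ↦ by
        obtain ⟨t, ht⟩ := hT 1 y
        simpa [ht] using N.smul_mem t hx)
    have hI (x : A) : x ∈ I ↔ x ∈ N := by simp [I, TwoSidedIdeal.mem_mk']
    rcases IsSimpleRing.simple.eq_bot_or_eq_top I with h | h
    · left
      refine (Submodule.eq_bot_iff _).2 fun x hx ↦ ?_
      simpa [h] using (hI x).2 hx
    · right
      refine eq_top_iff.2 fun x _ ↦ (hI x).1 (by simp [h])
  have hcomm (c : Module.End T A) (x : A) : f (c x) = c (f x) := by
    have h1 (y : A) : c y = y * c 1 := by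
      obtain ⟨t, ht⟩ := hT y 1
      simpa [ht] using c.map_smul t 1
    have h2 (y : A) : c y = c 1 * y := by
      obtain ⟨t, ht⟩ := hT 1 y
      simpa [ht] using c.map_smul t 1
    have h3 : c 1 ∈ Subalgebra.center F A :=
      Subalgebra.mem_center_iff.2 fun y ↦ by rw [← h1, ← h2]
    obtain ⟨r, hr⟩ := (Algebra.IsCentral.mem_center_iff F).1 h3
    rw [h2, h2 (f x), hr, ← Algebra.smul_def, ← Algebra.smul_def, map_smul]
  let f' : Module.End (Module.End T A) A :=
    { toFun := f, map_add' := f.map_add, map_smul' := hcomm }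
  let b := Module.finBasis F A
  obtain ⟨⟨_, t, rfl⟩, ht⟩ := jacobson_density (R := T) (M := A) f' (Finset.univ.image b)
  refine ⟨t, b.ext fun i ↦ ?_⟩
  exact (ht (b i) (by simp)).symm

theorem isSimpleRing_tensorProduct [FiniteDimensional F A] [Algebra.IsCentral F A]
    [IsSimpleRing A] : IsSimpleRing (L ⊗[F] A) := by
  refine .of_eq_bot_or_eq_top fun I ↦ ?_
  by_cases hI : I = ⊥
  · exact .inl hI
  right
  obtain ⟨x, hx, hx0⟩ : ∃ x ∈ I, x ≠ 0 := by
    by_contra! h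
    exact hI (eq_bot_iff.2 fun x hx ↦ by simpa using h x hx)
  have hstab (t : A ⊗[F] Aᵐᵒᵖ) : (AlgHom.mulLeftRight F A t).lTensor L x ∈ I := by
    induction t using TensorProduct.induction_on with
    | zero => simp
    | add s t hs ht => simpa [LinearMap.lTensor_add] using I.add_mem hs ht
    | tmul a c =>
      have : (AlgHom.mulLeftRight F A (a ⊗ₜ c)).lTensor L x
          = ((1 : L) ⊗ₜ[F] a) * x * ((1 : L) ⊗ₜ[F] c.unop) := by
        clear hx hx0
        induction x using TensorProduct.induction_on with
        | zero => simp
        | add y z hy hz => rw [map_add, hy, hz, mul_add, add_mul]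
        | tmul l y => simp
      rw [this]
      exact I.mul_mem_right _ _ (I.mul_mem_left _ _ hx)
  let b := Module.finBasis F A
  let B := b.baseChange L
  obtain ⟨i, hi⟩ : ∃ i, B.repr x i ≠ 0 := by
    by_contra! h
    exact hx0 (B.repr.map_eq_zero_iff.1 (Finsupp.ext h))
  obtain ⟨t, ht⟩ := exists_mulLeftRight_eq F A ((b.coord i).smulRight (1 : A))
  have key : (AlgHom.mulLeftRight F A t).lTensor L x = B.repr x i ⊗ₜ[F] (1 : A) := by
    rw [ht]
    clear hi hx hx0 hstab ht
    induction x using TensorProduct.induction_on with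
    | zero => simp
    | add y z hy hz => rw [map_add, hy, hz, map_add, Finsupp.add_apply, TensorProduct.add_tmul]
    | tmul l y => simp [B, TensorProduct.smul_tmul', TensorProduct.tmul_smul]
  have h1 := I.mul_mem_left ((B.repr x i)⁻¹ ⊗ₜ[F] (1 : A)) _ (key ▸ hstab t)
  rw [Algebra.TensorProduct.tmul_mul_tmul, inv_mul_cancel₀ hi, mul_one] at h1
  exact I.one_mem_iff.1 h1

theorem isCentral_tensorProduct [Algebra.IsCentral F A] :
    Algebra.IsCentral L (L ⊗[F] A) where
  out := fun x hx ↦ by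
    have h : x ∈ Subalgebra.centralizer F
        (Algebra.TensorProduct.includeRight '' (Set.univ : Set A) : Set (L ⊗[F] A)) := by
      rw [Subalgebra.mem_centralizer_iff]
      rintro y -
      exact Subalgebra.mem_center_iff.1 hx y
    rw [Subalgebra.centralizer_coe_image_includeRight_eq_center_tensorProduct] at h
    obtain ⟨y, rfl⟩ := h
    clear hx
    induction y using TensorProduct.induction_on with
    | zero => simp
    | add y z hy hz => rw [map_add]; exact add_mem hy hz
    | tmul l c =>
      obtain ⟨c, hc⟩ := c
      have hc' : c ∈ Subalgebra.center F A := by simpa using hc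
      obtain ⟨r, rfl⟩ := (Algebra.IsCentral.mem_center_iff F).1 hc'
      refine Algebra.mem_bot.2 ⟨r • l, ?_⟩
      simp [Algebra.TensorProduct.algebraMap_apply, Algebra.algebraMap_eq_smul_one (A := A),
        TensorProduct.smul_tmul']

theorem exists_splitting [IsSepClosed L] [FiniteDimensional F A] [Algebra.IsCentral F A]
    [IsSimpleRing A] :
    ∃ k : ℕ, Nonempty (L ⊗[F] A ≃ₐ[L] Matrix (Fin k) (Fin k) L) := by
  have := isSimpleRing_tensorProduct F L A
  have := isCentral_tensorProduct F L A
  have : IsArtinianRing (L ⊗[F] A) := IsArtinianRing.of_finite L _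
  obtain ⟨k, _, D, _, _, _, ⟨e⟩⟩ :=
    IsSimpleRing.exists_algEquiv_matrix_divisionRing_finite L (L ⊗[F] A)
  have hM : Algebra.IsCentral L (Matrix (Fin k) (Fin k) D) := Algebra.IsCentral.of_algEquiv L _ _ e
  have hD : Algebra.IsCentral L D := ⟨fun z hz ↦ by
    have hz' : Matrix.scalar (Fin k) z ∈ Subalgebra.center L (Matrix (Fin k) (Fin k) D) := by
      rw [Matrix.subalgebraCenter_eq_scalarAlgHom_map]
      exact ⟨z, hz, rfl⟩
    obtain ⟨r, hr⟩ := (Algebra.IsCentral.mem_center_iff L).1 hz'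
    refine Algebra.mem_bot.2 ⟨r, ?_⟩
    have := congrFun (congrFun hr 0) 0
    simpa [Matrix.algebraMap_matrix_apply] using this.symm⟩
  have htop : (⊥ : Subalgebra L D) = ⊤ := by
    by_contra hne
    obtain ⟨x, hx, hsep⟩ := JacobsonNoether.exists_separable_and_not_isCentral' hne
    have hint : IsIntegral L x := Algebra.IsIntegral.isIntegral x
    have hdeg := IsSepClosed.degree_eq_one_of_irreducible L (minpoly.irreducible hint) hsep
    exact hx (Algebra.mem_bot.2 (minpoly.mem_range_of_degree_eq_one L x hdeg))
  have hbij : Function.Bijective (Algebra.ofId L D) :=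
    ⟨(Algebra.ofId L D).injective, fun x ↦ Algebra.mem_bot.1 (htop ▸ Algebra.mem_top)⟩
  exact ⟨k, ⟨e.trans (AlgEquiv.ofBijective (Algebra.ofId L D) hbij).symm.mapMatrix⟩⟩

theorem det_algEquiv {k : ℕ} (ψ : Matrix (Fin k) (Fin k) L ≃ₐ[L] Matrix (Fin k) (Fin k) L)
    (X : Matrix (Fin k) (Fin k) L) : (ψ X).det = X.det := by
  let t := Matrix.toLinAlgEquiv' (R := L) (n := Fin k)
  obtain ⟨T, hT⟩ := ((t.symm.trans ψ).trans t).eq_linearEquivConjAlgEquiv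
  have h : t (ψ X) = T.conjAlgEquiv L (t X) := by rw [← hT]; simp
  have h2 (Y : Matrix (Fin k) (Fin k) L) : LinearMap.det (t Y) = Y.det :=
    LinearMap.det_toLin' Y
  rw [← h2, h, ← h2 X]
  exact LinearMap.det_conj (t X) T

theorem det_mem_range [IsGalois F L] {k : ℕ}
    (e : L ⊗[F] A ≃ₐ[L] Matrix (Fin k) (Fin k) L) (a : A) :
    (e (1 ⊗ₜ a)).det ∈ Set.range (algebraMap F L) := by
  rw [InfiniteGalois.mem_range_algebraMap_iff_fixed]
  intro σ
  let ρ : Matrix (Fin k) (Fin k) L ≃+* Matrix (Fin k) (Fin k) L :=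
    ((e.symm.toRingEquiv.trans
      (Algebra.TensorProduct.congr σ (AlgEquiv.refl : A ≃ₐ[F] A)).toRingEquiv).trans
        e.toRingEquiv).trans (σ.symm.mapMatrix (m := Fin k)).toRingEquiv
  have hρ (l : L) : ρ (algebraMap L _ l) = algebraMap L _ l := by
    have h1 : e (σ l ⊗ₜ[F] (1 : A)) = algebraMap L _ (σ l) := by
      rw [← e.commutes]; rfl
    have h2 : e.symm (algebraMap L _ l) = l ⊗ₜ[F] (1 : A) := by
      rw [e.symm.commutes]; rfl
    change σ.symm.mapMatrix (e (Algebra.TensorProduct.congr σ AlgEquiv.refl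
      (e.symm (algebraMap L _ l)))) = _
    rw [h2, Algebra.TensorProduct.congr_apply, Algebra.TensorProduct.map_tmul]
    erw [h1]
    ext i j
    by_cases hij : i = j <;> simp [Matrix.algebraMap_matrix_apply, hij]
  have h := det_algEquiv L (AlgEquiv.ofRingEquiv (f := ρ) hρ) (e (1 ⊗ₜ a))
  have h3 : AlgEquiv.ofRingEquiv (f := ρ) hρ (e (1 ⊗ₜ a)) = σ.symm.mapMatrix (e (1 ⊗ₜ a)) := by
    change σ.symm.mapMatrix (e (Algebra.TensorProduct.congr σ AlgEquiv.refl
      (e.symm (e (1 ⊗ₜ a))))) = _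
    rw [e.symm_apply_apply]
    simp
  rw [h3, ← AlgEquiv.map_det] at h
  rw [← h, AlgEquiv.apply_symm_apply, h]

end

section
variable (F A : Type*) [Field F] [Ring A] [Algebra F A] [FiniteDimensional F A]
  [Algebra.IsCentral F A] [IsSimpleRing A]

/-- A chosen isomorphism `Fˢ ⊗ A ≃ M_k(Fˢ)`, where `Fˢ` is the separable closure of `F`. -/
noncomputable def splitting :
    SeparableClosure F ⊗[F] A ≃ₐ[SeparableClosure F]
      Matrix (Fin (exists_splitting F (SeparableClosure F) A).choose)
        (Fin (exists_splitting F (SeparableClosure F) A).choose) (SeparableClosure F) :=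
  (exists_splitting F (SeparableClosure F) A).choose_spec.some

/-- The reduced norm `Nrd : A → F` of a central simple `F`-algebra `A`: the element `Nrd a` of `F` is
the determinant of the image of `1 ⊗ a` under an isomorphism `Fˢ ⊗ A ≃ M_k(Fˢ)`. (By `det_algEquiv`
it does not depend on the isomorphism.) -/
noncomputable def reducedNorm : A →* F where
  toFun a := (det_mem_range F (SeparableClosure F) A (splitting F A) a).choose
  map_one' := by
    apply (algebraMap F (SeparableClosure F)).injective
    rw [(det_mem_range F (SeparableClosure F) A (splitting F A) 1).choose_spec,
      ← Algebra.TensorProduct.one_def]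
    simp
  map_mul' a b := by
    apply (algebraMap F (SeparableClosure F)).injective
    rw [map_mul, (det_mem_range F (SeparableClosure F) A (splitting F A) (a * b)).choose_spec,
      (det_mem_range F (SeparableClosure F) A (splitting F A) a).choose_spec,
      (det_mem_range F (SeparableClosure F) A (splitting F A) b).choose_spec,
      ← Matrix.det_mul, ← map_mul, Algebra.TensorProduct.tmul_mul_tmul, one_mul]

theorem algebraMap_reducedNorm (a : A) :
    algebraMap F (SeparableClosure F) (reducedNorm F A a) = (splitting F A (1 ⊗ₜ a)).det :=
  (det_mem_range F (SeparableClosure F) A (splitting F A) a).choose_spec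

end
end CSA


/-! ### Smooth representations -/

namespace Representation

variable {G V : Type*} [Group G] [AddCommGroup V] [Module ℂ V]

/-- A representation is smooth if every vector has an open stabilizer. -/
def IsSmooth [TopologicalSpace G] (ρ : Representation ℂ G V) : Prop :=
  ∀ v : V, IsOpen {g : G | ρ g v = v}

/-- The twist `ρ ⊗ ω` of a representation by a character `ω`, realised on the space of `ρ`. -/
def twist (ρ : Representation ℂ G V) (ω : G →* ℂˣ) : Representation ℂ G V where
  toFun g := (ω g : ℂ) • ρ g
  map_one' := by simp
  map_mul' g h := by
    ext v
    simp only [map_mul, Units.val_mul, LinearMap.smul_apply, Module.End.mul_apply, map_smul,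
      mul_smul]
    exact smul_comm _ _ _

/-- `π` is (isomorphic to) a direct summand of `ρ`. -/
def IsDirectSummand {W : Type*} [AddCommGroup W] [Module ℂ W]
    (π : Representation ℂ G W) (ρ : Representation ℂ G V) : Prop :=
  ∃ U U' : Subrepresentation ρ, IsCompl U U' ∧ Nonempty (π.Equiv U.toRepresentation)

end Representation

/-! ### Hereditary orders and the normalized level -/

namespace InnerForm

open ValuativeRel

section Orders

variable {F M : Type*} [Field F] [ValuativeRel F] [Ring M] [Algebra F M]

/-- A hereditary `𝒪_F`-order in a finite dimensional `F`-algebra `M`: a subring of `M` which is a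
finitely generated `𝒪_F`-submodule spanning `M` over `F`, all of whose left ideals are
projective. (For orders this is equivalent to the same condition on right ideals.) -/
structure IsHereditaryOrder (𝔄 : Subalgebra 𝒪[F] M) : Prop where
  fg : (Subalgebra.toSubmodule 𝔄).FG
  span_eq_top : Submodule.span F (𝔄 : Set M) = ⊤
  projective : ∀ I : Ideal 𝔄, Module.Projective 𝔄 I

/-- The Jacobson radical `𝔓` of `𝔄`, as an `𝒪_F`-submodule of `M`. -/
noncomputable def radical (𝔄 : Subalgebra 𝒪[F] M) : Submodule 𝒪[F] M :=
  ((Ring.jacobson 𝔄).restrictScalars 𝒪[F]).map 𝔄.val.toLinearMap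

/-- `e = e_F(𝔄)`, that is, `e` is the positive integer with `𝔭_F 𝔄 = 𝔓 ^ e`. -/
def IsPeriod (𝔄 : Subalgebra 𝒪[F] M) (e : ℕ) : Prop :=
  0 < e ∧ 𝓂[F] • Subalgebra.toSubmodule 𝔄 = radical 𝔄 ^ e

/-- The group `U^j(𝔄) = 1 + 𝔓 ^ j` for `j ≥ 1`. (Elements of `1 + 𝔓` are automatically units of
`𝔄`, since `𝔓` is the Jacobson radical.) -/
def principalUnits (𝔄 : Subalgebra 𝒪[F] M) (j : ℕ) : Set Mˣ :=
  {g | (g : M) - 1 ∈ radical 𝔄 ^ j}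

variable (F) in
/-- Let `H` be a subgroup of `Mˣ`, with inclusion `ι`. The normalized level of a representation `ρ`
of `H` is the minimum of the numbers `j / e_F(𝔄)`, where `j ≥ 0` is an integer and `𝔄` a hereditary
`𝒪_F`-order in `M` such that `ρ` contains the trivial character of `U^(j+1)(𝔄) ∩ H`, that is, has a
nonzero vector fixed by this group. It is formed in `[0, ∞]`, so that it would be `∞` if there were
no such pair `(j, 𝔄)`. -/
noncomputable def normalizedLevel {H V : Type*} [Group H] [AddCommGroup V] [Module ℂ V]
    (ι : H →* Mˣ) (ρ : Representation ℂ H V) : ℝ≥0∞ :=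
  sInf {r | ∃ (j e : ℕ) (𝔄 : Subalgebra 𝒪[F] M), IsHereditaryOrder 𝔄 ∧ IsPeriod 𝔄 e ∧
    (∃ v : V, v ≠ 0 ∧ ∀ h : H, ι h ∈ principalUnits 𝔄 (j + 1) → ρ h v = v) ∧
    r = (j : ℝ≥0∞) / (e : ℝ≥0∞)}

end Orders

/-! ### The groups `GL_m(D)` and `GL_m(D)_der` -/

/-- The group `GL_m(D)`. -/
abbrev GLD (m : ℕ) (D : Type*) [DivisionRing D] : Type _ := (Matrix (Fin m) (Fin m) D)ˣ

section Groups

variable (F D : Type*) [Field F] [DivisionRing D] [Algebra F D] [FiniteDimensional F D]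
  [Algebra.IsCentral F D] (m : ℕ) [NeZero m]

/-- The reduced norm `Nrd : GL_m(D) → Fˣ`. -/
noncomputable def nrd : GLD m D →* Fˣ :=
  Units.map (CSA.reducedNorm F (Matrix (Fin m) (Fin m) D))

/-- The group `GL_m(D)_der`, the kernel of the reduced norm. -/
noncomputable def derGroup : Subgroup (GLD m D) := (nrd F D m).ker

variable {D m} [ValuativeRel F] {V : Type*} [AddCommGroup V] [Module ℂ V]

/-- The depth (normalized level) of a representation of `GL_m(D)`. -/
noncomputable def depth (ρ : Representation ℂ (GLD m D) V) : ℝ≥0∞ :=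
  normalizedLevel F (MonoidHom.id (GLD m D)) ρ

/-- The depth (normalized level) of a representation of `GL_m(D)_der`. -/
noncomputable def depthDer (ρ : Representation ℂ (derGroup F D m) V) : ℝ≥0∞ :=
  normalizedLevel F (derGroup F D m).subtype ρ

end Groups

end InnerForm

/-!
Restricting to `G_der` cannot raise the depth. If `πbar` has a vector fixed by `U^(j+1)(𝔄)`, then some
`G`-translate of it has a nonzero component in the summand `π`, since the complement of `π` contains
no nonzero `G`-stable subspace (`Representation.IsDirectSummand.exists_translate_component`). That
component is fixed by `U^(j+1)(g𝔄g⁻¹) ∩ G_der`, and `g𝔄g⁻¹` is a hereditary order with the same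
period.

Conversely, let `v` in `π ⊆ πbar` be fixed by `K ∩ G_der`, where `K = U^(j+1)(𝔄)`. The group `K` is
compact, so `v` has a finite orbit under `K`, and `K` acts on the span of this orbit through the
commutative group `K / (K ∩ G_der)`, which is isomorphic to `Nrd(K)`. Hence there is a vector on which
`K` acts by a character of `Nrd(K)`. Because `Nrd` is continuous (`InnerForm.continuous_reducedNorm`)
and `K` is compact, this character is trivial on the intersection of `Nrd(K)` with a small open
subgroup of `Fˣ`; because `ℂˣ` is divisible, it is then the restriction of a continuous character `χ`
of `Fˣ` (`exists_continuous_character_extending`). The twist of `πbar` by `χ⁻¹ ∘ Nrd` has a vector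
fixed by `K`, so its depth is at most `j / e_F(𝔄)`, and the minimality of the depth of `πbar` among
its twists gives the other inequality.
-/

/-! ### Principal units of an order -/

namespace InnerForm

open ValuativeRel

section Orders

variable {F M : Type*} [Field F] [ValuativeRel F] [Ring M] [Algebra F M]

theorem mul_mem_radical_pow {𝔄 : Subalgebra 𝒪[F] M} {j : ℕ} {a x : M} (ha : a ∈ 𝔄)
    (hx : x ∈ radical 𝔄 ^ (j + 1)) : a * x ∈ radical 𝔄 ^ (j + 1) := by
  have h : Subalgebra.toSubmodule 𝔄 * radical 𝔄 ≤ radical 𝔄 := by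
    rw [Submodule.mul_le]
    rintro b hb _ ⟨y, hy, rfl⟩
    exact ⟨⟨b, hb⟩ * y, Ideal.mul_mem_left _ _ hy, rfl⟩
  have h' : Subalgebra.toSubmodule 𝔄 * radical 𝔄 ^ (j + 1) ≤ radical 𝔄 ^ (j + 1) := by
    rw [pow_succ', ← mul_assoc]
    exact mul_le_mul_left h _
  exact h' (Submodule.mul_mem_mul ha hx)

theorem radical_le (𝔄 : Subalgebra 𝒪[F] M) : radical 𝔄 ≤ Subalgebra.toSubmodule 𝔄 := by
  rintro _ ⟨y, -, rfl⟩
  exact y.2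

theorem radical_pow_succ_le_radical (𝔄 : Subalgebra 𝒪[F] M) (j : ℕ) :
    radical 𝔄 ^ (j + 1) ≤ radical 𝔄 := by
  induction j with
  | zero => simp
  | succ j ih =>
    rw [pow_succ, Submodule.mul_le]
    intro a ha b hb
    simpa using mul_mem_radical_pow (j := 0) (radical_le 𝔄 (ih ha)) (by simpa using hb)

/-- A unit of `M` in `1 + 𝔓` has its inverse in `𝔄`. -/
theorem inv_mem_of_sub_one_mem_radical {𝔄 : Subalgebra 𝒪[F] M} {g : Mˣ}
    (hg : (g : M) - 1 ∈ radical 𝔄) : ((g⁻¹ : Mˣ) : M) ∈ 𝔄 := by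
  obtain ⟨y, hy, hyg⟩ := hg
  have hy' : y ∈ Ideal.jacobson (⊥ : Ideal 𝔄) := by
    rwa [Ideal.jacobson_bot]
  obtain ⟨z, hz⟩ := Ideal.mem_jacobson_iff.1 hy' 1
  have h1 : (z : M) * g = 1 := by
    have h2 := congrArg (fun t : 𝔄 ↦ (t : M)) ((Submodule.mem_bot _).1 hz)
    have h3 : (y : M) = g - 1 := hyg
    simp only [mul_one, AddSubgroupClass.coe_sub, Subalgebra.coe_add, Subalgebra.coe_mul,
      Subalgebra.coe_one, ZeroMemClass.coe_zero, h3, mul_sub, sub_add_cancel] at h2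
    exact sub_eq_zero.1 h2
  have h2 : ((g⁻¹ : Mˣ) : M) = z := by
    rw [← one_mul ((g⁻¹ : Mˣ) : M), ← h1, mul_assoc, Units.mul_inv, mul_one]
  rw [h2]
  exact z.2

/-- For `j ≥ 0` the set `U^(j+1)(𝔄)` is a subgroup of `Mˣ`. -/
noncomputable def principalUnitsSubgroup (𝔄 : Subalgebra 𝒪[F] M) (j : ℕ) : Subgroup Mˣ where
  carrier := principalUnits 𝔄 (j + 1)
  one_mem' := by simp [principalUnits]
  mul_mem' {g h} hg hh := by
    have hg' : (g : M) ∈ 𝔄 := by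
      simpa using add_mem (radical_le 𝔄 (radical_pow_succ_le_radical 𝔄 j hg)) (one_mem 𝔄)
    have : ((g * h : Mˣ) : M) - 1 = g * ((h : M) - 1) + (g - 1) := by
      push_cast; noncomm_ring
    rw [principalUnits, Set.mem_ofPred_eq, this]
    exact add_mem (mul_mem_radical_pow hg' hh) hg
  inv_mem' {g} hg := by
    have : ((g⁻¹ : Mˣ) : M) - 1 = -(((g⁻¹ : Mˣ) : M) * ((g : M) - 1)) := by
      rw [mul_sub, Units.inv_mul, mul_one, neg_sub]
    rw [principalUnits, Set.mem_ofPred_eq, this]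
    exact neg_mem (mul_mem_radical_pow
      (inv_mem_of_sub_one_mem_radical (radical_pow_succ_le_radical 𝔄 j hg)) hg)

/-! ### Orders under automorphisms -/

/-- The image of an order under an automorphism of the ambient algebra. -/
noncomputable def mapOrder (σ : M ≃ₐ[F] M) (𝔄 : Subalgebra 𝒪[F] M) : Subalgebra 𝒪[F] M :=
  𝔄.map (σ.restrictScalars 𝒪[F] : M →ₐ[𝒪[F]] M)

/-- An automorphism of the ambient algebra identifies an order with its image. -/
noncomputable def mapOrderEquiv (σ : M ≃ₐ[F] M) (𝔄 : Subalgebra 𝒪[F] M) :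
    𝔄 ≃ₐ[𝒪[F]] mapOrder σ 𝔄 :=
  (σ.restrictScalars 𝒪[F]).subalgebraMap 𝔄

theorem toSubmodule_mapOrder (σ : M ≃ₐ[F] M) (𝔄 : Subalgebra 𝒪[F] M) :
    Subalgebra.toSubmodule (mapOrder σ 𝔄) =
      (Subalgebra.toSubmodule 𝔄).map (σ.restrictScalars 𝒪[F]).toLinearMap := rfl

theorem radical_mapOrder (σ : M ≃ₐ[F] M) (𝔄 : Subalgebra 𝒪[F] M) :
    radical (mapOrder σ 𝔄) = (radical 𝔄).map (σ.restrictScalars 𝒪[F]).toLinearMap := by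
  let E := (mapOrderEquiv σ 𝔄).toRingEquiv
  have key : ∀ a : 𝔄, E a ∈ Ring.jacobson (mapOrder σ 𝔄) ↔ a ∈ Ring.jacobson 𝔄 := by
    intro a
    have h₁ : RingHomSurjective E.toRingHom := ⟨E.surjective⟩
    have h₂ : RingHomSurjective E.symm.toRingHom := ⟨E.symm.surjective⟩
    constructor
    · intro h
      simpa using Ring.le_comap_jacobson E.symm.toRingHom h
    · intro h
      exact Ring.le_comap_jacobson E.toRingHom h
  ext x
  constructor
  · rintro ⟨y, hy, rfl⟩
    obtain ⟨a, rfl⟩ := E.surjective y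
    exact ⟨a, ⟨a, (key a).1 hy, rfl⟩, rfl⟩
  · rintro ⟨_, ⟨a, ha, rfl⟩, rfl⟩
    exact ⟨E a, (key a).2 ha, rfl⟩

theorem radical_mapOrder_pow (σ : M ≃ₐ[F] M) (𝔄 : Subalgebra 𝒪[F] M) (n : ℕ) :
    radical (mapOrder σ 𝔄) ^ n = (radical 𝔄 ^ n).map (σ.restrictScalars 𝒪[F]).toLinearMap := by
  rw [radical_mapOrder]
  exact (Submodule.map_pow _ (σ.restrictScalars 𝒪[F]).toAlgHom n).symm

theorem IsPeriod.mapOrder {𝔄 : Subalgebra 𝒪[F] M} {e : ℕ} (h : IsPeriod 𝔄 e) (σ : M ≃ₐ[F] M) :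
    IsPeriod (mapOrder σ 𝔄) e := by
  refine ⟨h.1, ?_⟩
  rw [radical_mapOrder_pow, toSubmodule_mapOrder, ← h.2, Submodule.map_smul'']

theorem IsHereditaryOrder.mapOrder {𝔄 : Subalgebra 𝒪[F] M} (h : IsHereditaryOrder 𝔄)
    (σ : M ≃ₐ[F] M) : IsHereditaryOrder (mapOrder σ 𝔄) where
  fg := by
    rw [toSubmodule_mapOrder]
    exact h.fg.map _
  span_eq_top := by
    have : ((InnerForm.mapOrder σ 𝔄 : Subalgebra 𝒪[F] M) : Set M)
        = σ.toLinearMap '' (𝔄 : Set M) := rfl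
    rw [this, Submodule.span_image, h.span_eq_top, Submodule.map_top]
    exact LinearMap.range_eq_top.2 σ.surjective
  projective I := by
    let E := (mapOrderEquiv σ 𝔄).toRingEquiv
    let J : Ideal 𝔄 := I.comap (E : 𝔄 →+* InnerForm.mapOrder σ 𝔄)
    have := h.projective J
    have h₁ := RingHomInvPair.of_ringEquiv E
    have h₂ := RingHomInvPair.of_ringEquiv E.symm
    let e : J ≃ₛₗ[(E : 𝔄 →+* InnerForm.mapOrder σ 𝔄)] I :=
      { toFun := fun x ↦ ⟨E x, x.2⟩
        invFun := fun y ↦ ⟨E.symm y, by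
          change E (E.symm y) ∈ I
          rw [E.apply_symm_apply]
          exact y.2⟩
        left_inv := fun x ↦ by ext; simp
        right_inv := fun y ↦ by ext; simp
        map_add' := fun x y ↦ by ext; simp
        map_smul' := fun r x ↦ by ext; simp }
    exact Module.Projective.of_equiv e

end Orders
end InnerForm

/-! ### Extension of characters -/

open Topology in
/-- The units of a field with a valuative topology have arbitrarily small open subgroups, namely the
groups of `u` with `v (u - 1) < γ`. -/
theorem nonarchimedeanGroup_units (F : Type*) [Field F] [ValuativeRel F] [TopologicalSpace F]
    [IsNonarchimedeanLocalField F] : NonarchimedeanGroup Fˣ where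
  is_nonarchimedean U hU := by
    rw [Units.isEmbedding_val₀.nhds_eq_comap, Filter.mem_comap] at hU
    obtain ⟨S, hS, hSU⟩ := hU
    rw [Units.val_one, IsValuativeTopology.mem_nhds_iff'] at hS
    obtain ⟨γ, hγ⟩ := hS
    let v := ValuativeRel.valuation F
    -- Radius at most `1` forces `v u = 1`, which is what makes the ball a subgroup.
    let δ : ValuativeRel.ValueGroupWithZero F := min γ.val 1
    have hδ : 0 < δ := lt_min (zero_lt_iff.2 γ.ne_zero) zero_lt_one
    have hv {u : Fˣ} (hu : v (u - 1) < δ) : v u = 1 := by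
      simpa using v.map_one_add_of_lt (hu.trans_le (min_le_right _ _))
    let N : Subgroup Fˣ :=
      { carrier := {u | v (u - 1) < δ}
        one_mem' := by simp [hδ]
        mul_mem' := fun {a b} ha hb ↦ by
          have h : ((a * b : Fˣ) : F) - 1 = a * (b - 1) + (a - 1) := by push_cast; ring
          rw [Set.mem_ofPred_eq, h]
          refine v.map_add_lt ?_ ha
          rwa [map_mul, hv ha, one_mul]
        inv_mem' := fun {a} ha ↦ by
          have h : ((a⁻¹ : Fˣ) : F) - 1 = -((a : F)⁻¹ * (a - 1)) := by
            rw [mul_sub, inv_mul_cancel₀ a.ne_zero]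
            simp
          rw [Set.mem_ofPred_eq, h, Valuation.map_neg, map_mul, map_inv₀, hv ha, inv_one, one_mul]
          exact ha }
    have hN : (N : Set Fˣ) ∈ 𝓝 (1 : Fˣ) := by
      rw [Units.isEmbedding_val₀.nhds_eq_comap]
      refine Filter.mem_comap.2 ⟨{y | v (y - 1) < δ}, ?_, fun _ hu ↦ hu⟩
      rw [Units.val_one, IsValuativeTopology.mem_nhds_iff']
      exact ⟨Units.mk0 _ hδ.ne', subset_rfl⟩
    refine ⟨⟨N, N.isOpen_of_mem_nhds hN⟩, fun u hu ↦ hSU (hγ ?_)⟩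
    have hu' : v (u - 1) < δ := hu
    exact hu'.trans_le (min_le_left _ _)

/-- A homomorphism to the divisible group `ℂˣ` extends along any homomorphism of groups to a
commutative group, as soon as it is trivial on the kernel. -/
theorem MonoidHom.exists_comp_eq_of_ker_le {P A : Type*} [Group P] [CommGroup A] (f : P →* A)
    (ψ : P →* ℂˣ) (h : f.ker ≤ ψ.ker) : ∃ χ : A →* ℂˣ, χ.comp f = ψ := by
  have hdiv : ∀ n : ℕ, n ≠ 0 → Function.Surjective fun a : Additive ℂˣ ↦ n • a := by
    intro n hn a
    obtain ⟨z, hz⟩ := IsAlgClosed.exists_pow_nat_eq (a.toMul : ℂ) (Nat.pos_of_ne_zero hn)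
    have hz0 : z ≠ 0 := by
      rintro rfl
      rw [zero_pow hn] at hz
      exact a.toMul.ne_zero hz.symm
    exact ⟨Additive.ofMul (Units.mk0 z hz0), Units.ext hz⟩
  let _ : DivisibleBy (Additive ℂˣ) ℕ := divisibleByOfSMulRightSurj _ _ (hdiv _)
  let _ : DivisibleBy (Additive ℂˣ) ℤ := AddGroup.divisibleByIntOfDivisibleByNat _
  let ψ' : f.range →* ℂˣ := f.rangeRestrict.liftOfSurjective f.rangeRestrict_surjective
    ⟨ψ, by rwa [MonoidHom.ker_rangeRestrict]⟩
  obtain ⟨χ, hχ⟩ := (Module.Baer.of_divisible (Additive ℂˣ)).extension_property_addMonoidHom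
    (MonoidHom.toAdditive f.range.subtype) f.range.subtype_injective (MonoidHom.toAdditive ψ')
  refine ⟨MonoidHom.toAdditive.symm χ, MonoidHom.ext fun p ↦ ?_⟩
  have h1 := DFunLike.congr_fun hχ (Additive.ofMul (f.rangeRestrict p))
  have h2 : ψ' (f.rangeRestrict p) = ψ p :=
    MonoidHom.liftOfRightInverse_comp_apply _ _ _ _ p
  rw [← h2]
  exact h1

/-- Let `N : G → A` be a continuous homomorphism and `K` a compact subgroup of `G`. A smooth
character of `K` that is trivial on `K ∩ ker N` has the form `χ ∘ N` for a continuous character `χ`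
of `A`. -/
theorem exists_continuous_character_extending {G A : Type*} [Group G] [TopologicalSpace G]
    [CommGroup A] [TopologicalSpace A] [T2Space A] [NonarchimedeanGroup A]
    (N : G →* A) (hN : Continuous N) (K : Subgroup G) (hK : IsCompact (K : Set G))
    (ψ : K →* ℂˣ) (hψ : IsOpen (ψ.ker : Set K)) (hψN : ∀ k : K, N k = 1 → ψ k = 1) :
    ∃ χ : A →ₜ* ℂˣ, ∀ k : K, χ (N k) = ψ k := by
  have : CompactSpace K := isCompact_iff_compactSpace.1 hK
  let f : K →* A := N.comp K.subtype
  have hf : Continuous f := hN.comp continuous_subtype_val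
  -- The elements of `N(K)` on which the character is nontrivial form a closed set without `1`.
  have hC : IsClosed (f '' (ψ.ker : Set K)ᶜ) := (hψ.isClosed_compl.isCompact.image hf).isClosed
  have h1C : (1 : A) ∈ (f '' (ψ.ker : Set K)ᶜ)ᶜ := by
    rintro ⟨k, hk, hk1⟩
    exact hk (hψN k hk1)
  obtain ⟨U, hU⟩ := NonarchimedeanGroup.is_nonarchimedean _ (hC.isOpen_compl.mem_nhds h1C)
  let g : K × (U : Subgroup A) →* A := f.coprod (U : Subgroup A).subtype
  obtain ⟨χ, hχ⟩ := g.exists_comp_eq_of_ker_le (ψ.comp (MonoidHom.fst _ _)) (by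
    rintro ⟨k, u⟩ hku
    have hku' : f k * u = 1 := hku
    have hfk : f k ∈ U := by
      rw [eq_inv_of_mul_eq_one_left hku']
      exact inv_mem u.2
    by_contra hk
    exact hU hfk ⟨k, hk, rfl⟩)
  have hχU : ∀ u ∈ U, χ u = 1 := fun u hu ↦ by
    simpa [g] using DFunLike.congr_fun hχ ((1 : K), (⟨u, hu⟩ : (U : Subgroup A)))
  refine ⟨⟨χ, ?_⟩, fun k ↦ ?_⟩
  · refine continuous_of_continuousAt_one χ ?_
    refine (continuousAt_const (y := (1 : ℂˣ))).congr ?_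
    filter_upwards [U.mem_nhds_one] with u hu using (hχU u hu).symm
  · have h := DFunLike.congr_fun hχ (k, (1 : (U : Subgroup A)))
    simp only [g, MonoidHom.comp_apply, MonoidHom.coprod_apply, map_one, mul_one] at h
    exact h

theorem t2Space_of_isNonarchimedeanLocalField (F : Type*) [Field F] [ValuativeRel F]
    [TopologicalSpace F] [IsNonarchimedeanLocalField F] : T2Space F := by
  let := IsTopologicalAddGroup.rightUniformSpace F
  have := isUniformAddGroup_of_addCommGroup (G := F)
  infer_instance

/-! ### Topology of the reduced norm and of the principal units -/

namespace InnerForm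
open ValuativeRel

section
variable (F M : Type*) [Field F] [Ring M] [Algebra F M] [FiniteDimensional F M]
  [TopologicalSpace F] [IsTopologicalRing F] [TopologicalSpace M] [IsModuleTopology F M]

include F in
theorem t2Space_of_isModuleTopology [T2Space F] : T2Space M := by
  let b := Module.finBasis F M
  exact T2Space.of_injective_continuous b.equivFun.injective
    (IsModuleTopology.continuous_of_linearMap (R := F) b.equivFun.toLinearMap)

/-- The reduced norm is a polynomial function of the coordinates: the determinant computing it is a
polynomial with coefficients in the separable closure, and any `F`-linear retraction of the
separable closure onto `F` carries it to a polynomial over `F` with the same values on `F`-points. -/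
theorem continuous_reducedNorm [Algebra.IsCentral F M] [IsSimpleRing M] :
    Continuous (CSA.reducedNorm F M) := by
  let b := Module.finBasis F M
  let L := SeparableClosure F
  obtain ⟨r, hr⟩ := (Algebra.linearMap F L).exists_leftInverse_of_injective
    (LinearMap.ker_eq_bot.2 (algebraMap F L).injective)
  let P : MvPolynomial (Fin (Module.finrank F M)) L :=
    (Matrix.of fun s t ↦
      ∑ i, MvPolynomial.C (CSA.splitting F M (1 ⊗ₜ b i) s t) * MvPolynomial.X i).det
  have hP (a : M) : algebraMap F L (CSA.reducedNorm F M a)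
      = P.eval fun i ↦ algebraMap F L (b.repr a i) := by
    rw [CSA.algebraMap_reducedNorm, RingHom.map_det]
    congr 1
    refine Matrix.ext fun s t ↦ ?_
    conv_lhs => rw [← b.sum_repr a, TensorProduct.tmul_sum, map_sum, Matrix.sum_apply]
    simp only [RingHom.mapMatrix_apply, Matrix.map_apply, Matrix.of_apply, map_sum, map_mul,
      MvPolynomial.eval_C, MvPolynomial.eval_X]
    refine Finset.sum_congr rfl fun i _ ↦ ?_
    rw [TensorProduct.tmul_smul, ← algebraMap_smul L (b.repr a i) ((1 : L) ⊗ₜ[F] b i), map_smul, Matrix.smul_apply,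
      smul_eq_mul, mul_comm]
  have hval (a : M) : CSA.reducedNorm F M a
      = ∑ s ∈ P.support, (∏ i, b.repr a i ^ s i) * r (P.coeff s) := by
    have h1 : r (algebraMap F L (CSA.reducedNorm F M a)) = CSA.reducedNorm F M a :=
      LinearMap.congr_fun hr _
    rw [← h1, hP, MvPolynomial.eval_eq', map_sum]
    refine Finset.sum_congr rfl fun s _ ↦ ?_
    rw [← smul_eq_mul (∏ i, b.repr a i ^ s i), ← map_smul, Algebra.smul_def, mul_comm, map_prod]
    simp only [map_pow]
  have hb (i) : Continuous fun a ↦ b.repr a i :=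
    IsModuleTopology.continuous_of_linearMap (R := F) (b.coord i)
  rw [show (CSA.reducedNorm F M : M → F) = fun a ↦
    ∑ s ∈ P.support, (∏ i, b.repr a i ^ s i) * r (P.coeff s) from funext hval]
  fun_prop

end

section
variable {F M : Type*} [Field F] [ValuativeRel F] [TopologicalSpace F]
  [IsNonarchimedeanLocalField F] [Ring M] [Algebra F M] [FiniteDimensional F M]
  [TopologicalSpace M] [IsModuleTopology F M]

omit [FiniteDimensional F M] in
/-- A finitely generated `𝒪_F`-submodule is a continuous image of a power of `𝒪_F`. -/
theorem isCompact_of_fg {N : Submodule 𝒪[F] M} (hN : N.FG) : IsCompact (N : Set M) := by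
  have : ContinuousAdd M := IsModuleTopology.toContinuousAdd F M
  obtain ⟨n, s, hs⟩ := Submodule.fg_iff_exists_fin_generating_family.1 hN
  let f : (Fin n → 𝒪[F]) → M := fun c ↦ ∑ i, (c i : F) • s i
  have hf : Continuous f := by fun_prop
  have : (N : Set M) = Set.range f := by
    ext x
    rw [← hs, SetLike.mem_coe, Submodule.mem_span_range_iff_exists_fun]
    rfl
  rw [this]
  exact isCompact_range hf

theorem isCompact_principalUnitsSubgroup {𝔄 : Subalgebra 𝒪[F] M} (h : IsHereditaryOrder 𝔄)
    (j : ℕ) : IsCompact (principalUnitsSubgroup 𝔄 j : Set Mˣ) := by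
  have : T2Space F := t2Space_of_isNonarchimedeanLocalField F
  have : T2Space M := t2Space_of_isModuleTopology F M
  have : IsTopologicalRing M := IsModuleTopology.isTopologicalRing F M
  have hfg : (radical 𝔄 ^ (j + 1)).FG := by
    have := isNoetherian_of_fg_of_noetherian _ h.fg
    exact Submodule.FG.of_le h.fg ((radical_pow_succ_le_radical 𝔄 j).trans (radical_le 𝔄))
  have hX : IsCompact ((fun x : M ↦ x - 1) ⁻¹' (radical 𝔄 ^ (j + 1) : Submodule 𝒪[F] M)) :=
    (Homeomorph.subRight (1 : M)).isCompact_preimage.2 (isCompact_of_fg hfg)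
  have hXop := hX.image MulOpposite.continuous_op
  -- The topology of `Mˣ` is induced from `M × Mᵐᵒᵖ`, so inverses have to be controlled as well.
  refine (Units.isClosedEmbedding_embedProduct.isCompact_preimage
    (hX.prod hXop)).of_isClosed_subset (hX.isClosed.preimage Units.continuous_val) ?_
  exact fun g hg ↦ ⟨hg, _, (principalUnitsSubgroup 𝔄 j).inv_mem hg, rfl⟩

end
end InnerForm

/-! ### Smooth vectors, eigenvectors and direct summands -/

namespace Representation

variable {G V : Type*} [Group G] [AddCommGroup V] [Module ℂ V]

/-- Commuting operators on a nonzero finite-dimensional space have a common eigenvector: as long as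
one of them is not scalar, pass to one of its eigenspaces. -/
theorem exists_common_eigenvector (ρ : Representation ℂ G V) (E : Submodule ℂ V)
    [FiniteDimensional ℂ E] (hE : E ≠ ⊥) (hstab : ∀ g, ∀ x ∈ E, ρ g x ∈ E)
    (hcomm : ∀ g h, ∀ x ∈ E, ρ g (ρ h x) = ρ h (ρ g x)) :
    ∃ w ∈ E, w ≠ 0 ∧ ∀ g, ∃ c : ℂ, ρ g w = c • w := by
  induction hn : Module.finrank ℂ E using Nat.strong_induction_on generalizing E with
  | _ n ih =>
  by_cases hscal : ∀ g, ∃ c : ℂ, ∀ x ∈ E, ρ g x = c • x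
  · obtain ⟨w, hw, hw0⟩ := E.ne_bot_iff.1 hE
    exact ⟨w, hw, hw0, fun g ↦ (hscal g).imp fun c hc ↦ hc w hw⟩
  push Not at hscal
  obtain ⟨g, hg⟩ := hscal
  have : Nontrivial E := E.nontrivial_iff_ne_bot.2 hE
  obtain ⟨μ, hμ⟩ := Module.End.exists_eigenvalue ((ρ g).restrict (hstab g))
  obtain ⟨⟨y, hyE⟩, hy⟩ := hμ.exists_hasEigenvector
  have hgy : ρ g y = μ • y := congrArg Subtype.val hy.apply_eq_smul
  have hy0 : y ≠ 0 := fun h ↦ hy.2 (Subtype.ext h)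
  let E' : Submodule ℂ V := E ⊓ Module.End.eigenspace (ρ g) μ
  have hE'E : E' < E := by
    refine lt_of_le_of_ne inf_le_left fun h ↦ ?_
    obtain ⟨x, hx, hx'⟩ := hg μ
    rw [← h] at hx
    exact hx' (Module.End.mem_eigenspace_iff.1 hx.2)
  have : FiniteDimensional ℂ E' := Submodule.finiteDimensional_of_le hE'E.le
  obtain ⟨w, hw, hw'⟩ := ih _ (hn ▸ Submodule.finrank_lt_finrank_of_lt hE'E) E'
    (E'.ne_bot_iff.2 ⟨y, ⟨hyE, Module.End.mem_eigenspace_iff.2 hgy⟩, hy0⟩)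
    (fun k x hx ↦ ⟨hstab k x hx.1, Module.End.mem_eigenspace_iff.2 (by
      rw [hcomm g k x hx.1, Module.End.mem_eigenspace_iff.1 hx.2, map_smul])⟩)
    (fun k l x hx ↦ hcomm k l x hx.1) rfl
  exact ⟨w, hw.1, hw'⟩

/-- The eigenvalues of a group on a common eigenvector form a character. -/
theorem exists_character_of_eigenvector (ρ : Representation ℂ G V) {w : V} (hw : w ≠ 0)
    (h : ∀ g, ∃ c : ℂ, ρ g w = c • w) : ∃ ψ : G →* ℂˣ, ∀ g, ρ g w = (ψ g : ℂ) • w := by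
  choose c hc using h
  have hinj := smul_left_injective ℂ hw
  let c' : G →* ℂ :=
    { toFun := c
      map_one' := hinj (by simp [← hc])
      map_mul' := fun g h ↦ hinj (by
        simp only [← hc, map_mul, Module.End.mul_apply]
        rw [hc h, map_smul, hc g, smul_smul, mul_comm]) }
  exact ⟨c'.toHomUnits, hc⟩

/-- Let `N` be a continuous homomorphism to a commutative group `A`, and let `K` be a compact
subgroup. If a smooth representation has a nonzero vector fixed by `K ∩ ker N`, then the commutative
group `K / (K ∩ ker N)` acts on the finite-dimensional space generated by that vector under `K`, and
an eigenvector there transforms under `K` by a character of `A`. -/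
theorem IsSmooth.exists_eigenvector_of_fixed_by_ker {A : Type*} [TopologicalSpace G]
    [IsTopologicalGroup G] [CommGroup A] [TopologicalSpace A] [T2Space A] [NonarchimedeanGroup A]
    {ρ : Representation ℂ G V} (hρ : ρ.IsSmooth) (N : G →* A) (hN : Continuous N)
    (K : Subgroup G) (hK : IsCompact (K : Set G)) {v : V} (hv : v ≠ 0)
    (hfix : ∀ k ∈ K, N k = 1 → ρ k v = v) :
    ∃ χ : A →ₜ* ℂˣ, ∃ w : V, w ≠ 0 ∧ ∀ k ∈ K, ρ k w = (χ (N k) : ℂ) • w := by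
  have : CompactSpace K := isCompact_iff_compactSpace.1 hK
  let ρK : Representation ℂ K V := ρ.comp K.subtype
  have horbit : (Set.range fun k : K ↦ ρK k v).Finite := by
    refine IsLocallyConstant.range_finite ((IsLocallyConstant.iff_isOpen_fiber_apply).2 fun k ↦ ?_)
    have h : (fun l : K ↦ ρK l v) ⁻¹' {ρK k v} = (fun l : K ↦ ((k⁻¹ : K) * l : G)) ⁻¹' {g | ρ g v = v} := by
      ext l
      have : ρ ((k⁻¹ : K) * l : G) v = ρ (k : G)⁻¹ (ρ l v) := by rw [← Module.End.mul_apply, ← map_mul]; rfl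
      simp only [Set.mem_preimage, Set.mem_singleton_iff, Set.mem_ofPred_eq, this]
      constructor
      · intro h
        rw [show ρ l v = ρ k v from h, ρ.inv_self_apply]
      · intro h
        change ρ l v = ρ k v
        conv_rhs => rw [← h]
        rw [ρ.self_inv_apply]
    rw [h]
    exact (hρ v).preimage (by fun_prop)
  let E : Submodule ℂ V := Submodule.span ℂ (Set.range fun k : K ↦ ρK k v)
  have : FiniteDimensional ℂ E := FiniteDimensional.span_of_finite ℂ horbit
  have hvE : v ∈ E := Submodule.subset_span ⟨1, by simp⟩
  have hstab : ∀ g, ∀ x ∈ E, ρK g x ∈ E := by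
    intro g x hx
    induction hx using Submodule.span_induction with
    | mem x hx =>
      obtain ⟨k, rfl⟩ := hx
      exact Submodule.subset_span ⟨g * k, by simp [map_mul]⟩
    | zero => simp
    | add x y _ _ hx hy => rw [map_add]; exact add_mem hx hy
    | smul c x _ hx => rw [map_smul]; exact E.smul_mem c hx
  have hEfix : ∀ k : K, N k = 1 → ∀ x ∈ E, ρK k x = x := by
    intro k hk x hx
    induction hx using Submodule.span_induction with
    | mem x hx =>
      obtain ⟨l, rfl⟩ := hx
      have h1 : ρK (l⁻¹ * k * l) v = v := hfix _ (l⁻¹ * k * l).2 (by simp [hk])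
      have h2 : ρK k (ρK l v) = ρK l (ρK (l⁻¹ * k * l) v) := by
        rw [← Module.End.mul_apply, ← Module.End.mul_apply, ← map_mul, ← map_mul]
        congr 2
        group
      exact h2.trans (by rw [h1])
    | zero => simp
    | add x y _ _ hx hy => rw [map_add, hx, hy]
    | smul c x _ hx => rw [map_smul, hx]
  have hcomm : ∀ g h, ∀ x ∈ E, ρK g (ρK h x) = ρK h (ρK g x) := by
    intro g h x hx
    have h1 : ρK ((h * g)⁻¹ * (g * h)) x = x := hEfix _ (by simp [mul_comm (N g)]) x hx
    have h2 : g * h = (h * g) * ((h * g)⁻¹ * (g * h)) := by group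
    rw [← Module.End.mul_apply, ← Module.End.mul_apply, ← map_mul, ← map_mul, h2, map_mul,
      Module.End.mul_apply, h1]
  obtain ⟨w, hwE, hw0, hw⟩ := ρK.exists_common_eigenvector E
    (E.ne_bot_iff.2 ⟨v, hvE, hv⟩) hstab hcomm
  obtain ⟨ψ, hψ⟩ := ρK.exists_character_of_eigenvector hw0 hw
  have hψ1 (k : K) : ψ k = 1 ↔ ρK k w = w := by
    rw [hψ, ← Units.val_inj, Units.val_one]
    exact ⟨fun h ↦ by rw [h, one_smul], fun h ↦ smul_left_injective ℂ hw0 (by simpa using h)⟩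
  have hopen : IsOpen (ψ.ker : Set K) := by
    have : (ψ.ker : Set K) = Subtype.val ⁻¹' {g : G | ρ g w = w} := Set.ext hψ1
    rw [this]
    exact (hρ w).preimage continuous_subtype_val
  obtain ⟨χ, hχ⟩ := exists_continuous_character_extending N hN K hK ψ hopen
    fun k hk ↦ (hψ1 k).2 (hEfix k hk w hwE)
  exact ⟨χ, w, hw0, fun k hk ↦ by rw [hχ ⟨k, hk⟩]; exact hψ ⟨k, hk⟩⟩

/-- Let `π` be a summand of the restriction to `H` of an irreducible representation `ρ` of `G`. Some
translate of a nonzero vector `v` of `ρ` has a nonzero component in `π`: otherwise all translates of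
`v` lie in the complement of `π`, whose largest `G`-stable subspace is zero. The component is fixed
by every element of `H` that fixes the translate. -/
theorem IsDirectSummand.exists_translate_component {W : Type*} [AddCommGroup W] [Module ℂ W]
    [Nontrivial W] {H : Subgroup G} {ρ : Representation ℂ G V} (hρ : ρ.IsIrreducible)
    {π : Representation ℂ H W} (hπ : π.IsDirectSummand (ρ.comp H.subtype)) {v : V} (hv : v ≠ 0) :
    ∃ g : G, ∃ w : W, w ≠ 0 ∧ ∀ h : H, ρ h (ρ g v) = ρ g v → π h w = w := by
  obtain ⟨U, U', hc, ⟨e⟩⟩ := hπ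
  have hdisj : ∀ x ∈ U, x ∈ U' → x = 0 := fun x hx hx' ↦ by
    have : x ∈ U ⊓ U' := ⟨hx, hx'⟩
    rwa [hc.inf_eq_bot] at this
  let X : Subrepresentation ρ :=
    { toSubmodule := ⨅ g : G, U'.toSubmodule.comap (ρ g)
      apply_mem_toSubmodule := fun g x hx ↦ by
        simp only [Submodule.mem_iInf, Submodule.mem_comap] at hx ⊢
        intro k
        simpa [map_mul] using hx (k * g) }
  have hX (x : V) : x ∈ X ↔ ∀ g, ρ g x ∈ U' := by
    change x ∈ ⨅ g : G, U'.toSubmodule.comap (ρ g) ↔ _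
    simp only [Submodule.mem_iInf, Submodule.mem_comap]
    rfl
  have hXbot : X = ⊥ := by
    refine (hρ.eq_bot_or_eq_top X).resolve_right fun htop ↦ ?_
    obtain ⟨w, hw⟩ := exists_ne (0 : W)
    have h1 : (e w : V) ∈ X := by rw [htop]; trivial
    have h2 : (e w : V) = 0 := hdisj _ (e w).2 (by simpa using (hX _).1 h1 1)
    exact hw ((map_eq_zero_iff e (EquivLike.injective e)).1 (Subtype.ext h2))
  obtain ⟨g, hg⟩ : ∃ g, ρ g v ∉ U' := by
    by_contra! h
    have : v ∈ X := (hX v).2 h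
    rw [hXbot] at this
    exact hv this
  have hmem : ρ g v ∈ U.toSubmodule ⊔ U'.toSubmodule := by
    rw [← Subrepresentation.toSubmodule_sup, hc.sup_eq_top]
    trivial
  obtain ⟨u, hu, u', hu', huu'⟩ := Submodule.mem_sup.1 hmem
  obtain ⟨w, hw⟩ := EquivLike.surjective e (⟨u, hu⟩ : U.toSubmodule)
  refine ⟨g, w, ?_, fun h hh ↦ ?_⟩
  · rintro rfl
    have hu0 : u = 0 := by simpa using congrArg Subtype.val hw.symm
    rw [← huu', hu0, zero_add] at hg
    exact hg hu'
  · rw [← huu', map_add] at hh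
    have h1 : ρ h u - u = u' - ρ h u' := by
      rw [sub_eq_sub_iff_add_eq_add, hh, add_comm]
    have h2 : ρ h u - u = 0 := hdisj _ (U.toSubmodule.sub_mem (U.apply_mem_toSubmodule h hu) hu)
      (h1 ▸ U'.toSubmodule.sub_mem hu' (U'.apply_mem_toSubmodule h hu'))
    refine EquivLike.injective e ?_
    have h3 : e (π h w) = U.toRepresentation h (e w) := e.toIntertwiningMap.isIntertwining _ _ h w
    rw [h3, hw]
    exact Subtype.ext (sub_eq_zero.1 h2)

end Representation

namespace InnerForm
open ValuativeRel

/-! ### Conjugation of principal units -/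

section
variable {F M : Type*} [Field F] [ValuativeRel F] [Ring M] [Algebra F M]

/-- Conjugation `a ↦ g a g⁻¹` by a unit. -/
noncomputable def conjAlgEquiv (F : Type*) {M : Type*} [Field F] [Ring M] [Algebra F M] (g : Mˣ) :
    M ≃ₐ[F] M :=
  MulSemiringAction.toAlgEquiv F M (ConjAct.toConjAct g)

theorem conj_mem_principalUnits {𝔄 : Subalgebra 𝒪[F] M} {j : ℕ} {g h : Mˣ}
    (hh : h ∈ principalUnits (mapOrder (conjAlgEquiv F g) 𝔄) j) :
    g⁻¹ * h * g ∈ principalUnits 𝔄 j := by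
  rw [principalUnits, Set.mem_ofPred_eq, radical_mapOrder_pow] at hh
  obtain ⟨x, hx, hxh⟩ := hh
  have hxh' : (g : M) * x * (g⁻¹ : Mˣ) = h - 1 := hxh
  have : ((g⁻¹ * h * g : Mˣ) : M) - 1 = x := by
    have h1 : (h : M) = g * x * (g⁻¹ : Mˣ) + 1 := by rw [hxh', sub_add_cancel]
    push_cast
    rw [h1]
    simp [mul_add, add_mul, mul_assoc]
  rw [principalUnits, Set.mem_ofPred_eq, this]
  exact hx

end

/-! ### Depth and restriction to the derived group -/

section
variable {F D V W : Type*} [Field F] [ValuativeRel F] [DivisionRing D] [Algebra F D]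
  [FiniteDimensional F D] [Algebra.IsCentral F D] {m : ℕ} [NeZero m] [AddCommGroup V] [Module ℂ V]
  [AddCommGroup W] [Module ℂ W]

/-- Restriction to the derived group does not increase the depth. -/
theorem depthDer_le_depth {πbar : Representation ℂ (GLD m D) V} (hirr : πbar.IsIrreducible)
    [Nontrivial W] {π : Representation ℂ (derGroup F D m) W}
    (hsummand : π.IsDirectSummand (πbar.comp (derGroup F D m).subtype)) :
    depthDer F π ≤ depth F πbar := by
  refine le_sInf ?_
  rintro r ⟨j, e, 𝔄, h𝔄, he, ⟨v, hv, hfix⟩, rfl⟩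
  obtain ⟨g, w, hw, hgw⟩ := hsummand.exists_translate_component hirr hv
  refine sInf_le ⟨j, e, mapOrder (conjAlgEquiv F g) 𝔄, h𝔄.mapOrder _, he.mapOrder _,
    ⟨w, hw, fun h hh ↦ hgw h ?_⟩, rfl⟩
  have h1 : πbar (g⁻¹ * h * g : GLD m D) v = v := hfix _ (conj_mem_principalUnits hh)
  conv_rhs => rw [← h1]
  rw [← Module.End.mul_apply, ← Module.End.mul_apply, ← map_mul, ← map_mul]
  congr 2
  group

/-- A vector fixed by `U^(j+1)(𝔄) ∩ G_der` bounds the depth of a suitable twist: some twist has a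
vector fixed by all of `U^(j+1)(𝔄)`. -/
theorem exists_depth_twist_le_of_fixed [TopologicalSpace F] [IsNonarchimedeanLocalField F]
    [TopologicalSpace D] [IsModuleTopology F D]
    {πbar : Representation ℂ (GLD m D) V} (hsmooth : πbar.IsSmooth)
    {𝔄 : Subalgebra 𝒪[F] (Matrix (Fin m) (Fin m) D)} (h𝔄 : IsHereditaryOrder 𝔄) {e j : ℕ}
    (he : IsPeriod 𝔄 e) {v : V} (hv : v ≠ 0)
    (hfix : ∀ h : derGroup F D m, (h : GLD m D) ∈ principalUnits 𝔄 (j + 1) → πbar h v = v) :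
    ∃ χ : Fˣ →ₜ* ℂˣ, depth F (πbar.twist ((χ : Fˣ →* ℂˣ).comp (nrd F D m))) ≤ j / e := by
  have : IsModuleTopology F (Matrix (Fin m) (Fin m) D) :=
    inferInstanceAs (IsModuleTopology F (Fin m → Fin m → D))
  have : IsTopologicalRing (Matrix (Fin m) (Fin m) D) := IsModuleTopology.isTopologicalRing F _
  have : T2Space F := t2Space_of_isNonarchimedeanLocalField F
  have : NonarchimedeanGroup Fˣ := nonarchimedeanGroup_units F
  have hN : Continuous (nrd F D m) := (continuous_reducedNorm F _).units_map _
  obtain ⟨χ, w, hw, hχ⟩ := hsmooth.exists_eigenvector_of_fixed_by_ker (nrd F D m) hN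
    (principalUnitsSubgroup 𝔄 j) (isCompact_principalUnitsSubgroup h𝔄 j) hv
    fun k hk hk1 ↦ hfix ⟨k, hk1⟩ hk
  refine ⟨χ⁻¹, sInf_le ⟨j, e, 𝔄, h𝔄, he, ⟨w, hw, fun k hk ↦ ?_⟩, rfl⟩⟩
  change (((χ (nrd F D m k))⁻¹ : ℂˣ) : ℂ) • πbar k w = w
  rw [hχ k hk, smul_smul, Units.inv_mul, one_smul]

end
end InnerForm

theorem mainTheorem8
    {F D V W : Type*}
    [Field F] [ValuativeRel F] [TopologicalSpace F] [IsNonarchimedeanLocalField F]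
    [DivisionRing D] [Algebra F D] [FiniteDimensional F D] [Algebra.IsCentral F D]
    [TopologicalSpace D] [IsModuleTopology F D]
    (m : ℕ) [NeZero m]
    [AddCommGroup V] [Module ℂ V] [AddCommGroup W] [Module ℂ W]
    (πbar : Representation ℂ (InnerForm.GLD m D) V)
    (hπbar_smooth : πbar.IsSmooth) (hπbar_irr : πbar.IsIrreducible)
    (π : Representation ℂ (InnerForm.derGroup F D m) W)
    (hπ_smooth : π.IsSmooth) (hπ_irr : π.IsIrreducible)
    (hsummand : π.IsDirectSummand (πbar.comp (InnerForm.derGroup F D m).subtype))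
    (hmin : ∀ χ : Fˣ →ₜ* ℂˣ, InnerForm.depth F πbar ≤
      InnerForm.depth F (πbar.twist ((χ : Fˣ →* ℂˣ).comp (InnerForm.nrd F D m)))) :
    InnerForm.depthDer F π = InnerForm.depth F πbar := by
  have : Nontrivial W := by
    by_contra h
    rw [not_nontrivial_iff_subsingleton] at h
    exact hπ_irr.exists_pair_ne.elim fun U ⟨U', hU⟩ ↦
      hU (SetLike.ext fun x ↦ by
        rw [Subsingleton.elim x 0]
        exact iff_of_true U.toSubmodule.zero_mem U'.toSubmodule.zero_mem)
  refine le_antisymm (InnerForm.depthDer_le_depth hπbar_irr hsummand) (le_sInf ?_)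
  rintro r ⟨j, e, 𝔄, h𝔄, he, ⟨w, hw, hfix⟩, rfl⟩
  obtain ⟨U, -, -, ⟨φ⟩⟩ := hsummand
  obtain ⟨χ, hχ⟩ := InnerForm.exists_depth_twist_le_of_fixed hπbar_smooth h𝔄 he (v := (φ w : V))
    (fun h ↦ hw ((map_eq_zero_iff φ (EquivLike.injective φ)).1 (Subtype.ext h))) fun h hh ↦ by
      have h1 : φ (π h w) = U.toRepresentation h (φ w) := φ.toIntertwiningMap.isIntertwining _ _ h w
      rw [hfix h hh] at h1
      exact (congrArg Subtype.val h1).symm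
  exact (hmin χ).trans hχ
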